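/- Let $H$ be a complex Hilbert space, $\mathcal B(H)$ the algebra of bounded linear operators on $H$ with the operator norm $\|\cdot\|$, $I$ the identity operator and $\mathbb D=\{z\in\mathbb C:|z|<1\}$. For self-adjoint $S,T\in\mathcal B(H)$ write $S>T$ if $\langle Sx,x\rangle>\langle Tx,x\rangle$ for all $x\in H\setminus\{0\}$; put $|T|=(T^*T)^{1/2}$ and let $\sigma(T)$ be the spectrum of $T$. A set $K\subset\mathbb C$ does not separate $0$ from $\infty$ if $0$ and $\infty$ lie in the same connected component of $(\mathbb C\cup\{\infty\})\setminus K$. For $z_1,z_2\in\mathbb C$ let $$\lambda(z_1,z_2)=\frac{|z_1-z_2|}{\sqrt{1+|z_1|^2}\,\sqrt{1+|z_2|^2}}$$ be the spherical distance. **Theorem.** Let $f:\mathbb D\to\mathcal B(H)$ be holomorphic with expansion $f(z)=\sum_{n=0}^\infty A_nz^n$, $z\in\mathbb D$, where $A_n\in\mathcal B(H)$. Suppose that for every $z\in\mathbb D$ one has $|f(z)|>I$, $f(z)$ is normal, and $\sigma(f(z))$ does not separate $0$ from $\infty$; suppose also that $f(0)=A_0>0$. Put $\rho=\log\|A_0\|/\|\log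 A_0\|$, where $\log A_0$ is given by the functional calculus with the principal logarithm. Then, for every $r$ with $$0\le r\le\frac{2\rho-1}{2\rho+1},$$ the series $\sum_{n=0}^\infty\|A_n\|r^n$ converges and $$\lambda\Big(\sum_{n=0}^\infty\|A_n\|r^n,\ \|A_0\|\Big)\le\lambda\big(\|A_0\|,1\big).$$ -/

import Mathlib

open scoped OnePoint InnerProductSpace

/-- The strict order `A < B` on bounded operators, in the sense of quadratic forms: `B - A` is a
(self-adjoint) positive operator and `⟨A x, x⟩ < ⟨B x, x⟩` for every nonzero vector `x`. -/
def OpStrictLT {H : Type*} [NormedAddCommGroup H] [InnerProductSpace ℂ H]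
    (A B : H →L[ℂ] H) : Prop :=
  (B - A).IsPositive ∧ ∀ x : H, x ≠ 0 → 0 < RCLike.re ⟪(B - A) x, x⟫_ℂ

/-- The set `K ⊆ ℂ` does not separate `0` from `∞`: both points belong to one and the same
connected component of the complement of `K` in the extended plane `ℂ ∪ {∞}`
(in particular `0 ∉ K`). -/
def NotSeparatesZeroInfty (K : Set ℂ) : Prop :=
  (∞ : OnePoint ℂ) ∈ connectedComponentIn (((↑) : ℂ → OnePoint ℂ) '' K)ᶜ ((0 : ℂ) : OnePoint ℂ)

/-- The spherical (chordal) distance on the extended plane `ℂ ∪ {∞}`. -/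
noncomputable def sphericalDist : OnePoint ℂ → OnePoint ℂ → ℝ
  | some z, some w => ‖z - w‖ / (√(1 + ‖z‖ ^ 2) * √(1 + ‖w‖ ^ 2))
  | some z, none => 1 / √(1 + ‖z‖ ^ 2)
  | none, some w => 1 / √(1 + ‖w‖ ^ 2)
  | none, none => 0

/-!
The values of `f` generate a commutative C⋆-algebra, and along each of its characters the claim
becomes a statement about scalar functions.

Comparing the coefficients of `z ^ n * conj z ^ m` in `f z * star (f z) = star (f z) * f z` shows
that `A n` commutes with `star (A m)` (`coeff_mul_star_coeff_comm`); in particular every `A n` is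
normal, so by Fuglede's theorem `A n` commutes with `A m` as well. All `A n` hence lie in a
commutative C⋆-algebra, in which `‖A n‖` is the supremum of `‖χ (A n)‖` over the characters `χ`
(`norm_coeff_le_of_isStarNormal`).

For a character `χ` the function `φ = χ ∘ f` is holomorphic on the disc, has modulus at least `1`,
and its value at `0` lies in `[1, ‖A 0‖]`. The disc being simply connected, `φ = exp g` with
`0 ≤ re g` and `g 0 = log (φ 0) ≤ L`, where `L = log ‖A 0‖`. Carathéodory's inequality
(`norm_iteratedDeriv_le_of_re_nonneg`) bounds the coefficients of `g` by those of
`L * (1 + z) / (1 - z)`, and exponentiation preserves such a domination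
(`iteratedDeriv_cexp_le`). Consequently `∑ ‖A n‖ * r ^ n ≤ exp (L * (1 + r) / (1 - r))`.

The spectral mapping theorem gives `‖log (A 0)‖ ≥ log ‖A 0‖`, so `ρ ≤ 1` and `r ≤ 1 / 3`. The sum
of the series thus lies between `‖A 0‖` and `‖A 0‖ ^ 2`, where the spherical distance inequality is
elementary (`sphericalDist_le_of_mem_Icc`).
-/

/-! ### Power series on the unit disc -/

lemma summable_norm_mul_pow_of_hasSum {E : Type*} [NormedAddCommGroup E] [NormedSpace ℂ E]
    {f : ℂ → E} {a : ℕ → E}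
    (h : ∀ z ∈ Metric.ball (0 : ℂ) 1, HasSum (fun n : ℕ => z ^ n • a n) (f z))
    {r : ℝ} (hr0 : 0 ≤ r) (hr : r < 1) : Summable (fun n : ℕ => ‖a n‖ * r ^ n) := by
  obtain ⟨R, hrR, hR1⟩ := exists_between hr
  have hR0 : 0 < R := hr0.trans_lt hrR
  have hR : ((R : ℝ) : ℂ) ∈ Metric.ball (0 : ℂ) 1 := by
    simpa [abs_of_pos hR0] using hR1
  have ht := (h _ hR).summable.tendsto_atTop_zero.norm.bddAbove_range
  obtain ⟨C, hC⟩ := ht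
  have hC' : ∀ n, ‖a n‖ * R ^ n ≤ C := fun n => by
    have := hC ⟨n, rfl⟩
    simpa [norm_smul, abs_of_pos hR0, mul_comm] using this
  have hq : r / R < 1 := (div_lt_one hR0).2 hrR
  refine Summable.of_nonneg_of_le (fun n => by positivity) (fun n => ?_)
    ((summable_geometric_of_lt_one (by positivity) hq).mul_left C)
  calc ‖a n‖ * r ^ n = (‖a n‖ * R ^ n) * (r / R) ^ n := by
        rw [div_pow]; field_simp
    _ ≤ C * (r / R) ^ n := by gcongr; exact hC' n

lemma hasFPowerSeriesOnBall_mkPiRing {𝕜 E : Type*} [NontriviallyNormedField 𝕜]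
    [NormedAddCommGroup E] [NormedSpace 𝕜 E] {f : 𝕜 → E} {a : ℕ → E}
    (hs : ∀ r : ℝ, 0 ≤ r → r < 1 → Summable (fun n : ℕ => ‖a n‖ * r ^ n))
    (h : ∀ z ∈ Metric.ball (0 : 𝕜) 1, HasSum (fun n : ℕ => z ^ n • a n) (f z)) :
    HasFPowerSeriesOnBall f
      (fun n => ContinuousMultilinearMap.mkPiRing 𝕜 (Fin n) (a n)) 0 1 where
  r_le := by
    refine ENNReal.le_of_forall_nnreal_lt fun r hr => ?_
    refine FormalMultilinearSeries.le_radius_of_summable_norm _ ?_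
    simpa using hs r r.2 (by exact_mod_cast hr)
  r_pos := one_pos
  hasSum := by
    intro y hy
    have hy' : y ∈ Metric.ball (0 : 𝕜) 1 := by
      simpa [Metric.mem_eball, edist_zero_right, enorm, ← NNReal.coe_lt_coe] using hy
    simpa using h y hy'

/-- Coefficients of a power series on the complex unit disc are given by derivatives at `0`. -/
lemma iteratedDeriv_eq_factorial_mul_of_hasSum {f : ℂ → ℂ} {a : ℕ → ℂ}
    (h : ∀ z ∈ Metric.ball (0 : ℂ) 1, HasSum (fun n : ℕ => z ^ n • a n) (f z)) (n : ℕ) :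
    iteratedDeriv n f 0 = n.factorial * a n := by
  have hp := hasFPowerSeriesOnBall_mkPiRing
    (fun r hr0 hr => summable_norm_mul_pow_of_hasSum h hr0 hr) h
  have := hp.factorial_smul (1 : ℂ) n
  rw [iteratedDeriv_eq_iteratedFDeriv]
  rw [← this]
  simp

/-- Coefficients of an `E`-valued power series vanish if its sum vanishes on `(-1, 1)`. -/
lemma eq_zero_of_hasSum_zero {E : Type*} [NormedAddCommGroup E] [NormedSpace ℝ E] {c : ℕ → E}
    (hs : ∀ r : ℝ, 0 ≤ r → r < 1 → Summable (fun n : ℕ => ‖c n‖ * r ^ n))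
    (h : ∀ s ∈ Metric.ball (0 : ℝ) 1, HasSum (fun n : ℕ => s ^ n • c n) 0) (n : ℕ) : c n = 0 := by
  have hp := hasFPowerSeriesOnBall_mkPiRing (f := fun _ => (0 : E)) hs h
  have := HasFPowerSeriesAt.eq_zero (p := _) ⟨_, hp⟩
  simpa using congrArg (fun q => q n (fun _ => (1 : ℝ))) this

/-! ### Normal-valued holomorphic functions -/

/-- A vector-valued polynomial that vanishes on the unit circle is zero. -/
lemma eq_zero_of_sum_pow_smul_eq_zero {E : Type*} [NormedAddCommGroup E] [NormedSpace ℂ E]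
    {N : ℕ} {c : ℕ → E}
    (h : ∀ ζ : ℂ, ‖ζ‖ = 1 → ∑ i ∈ Finset.range N, ζ ^ (2 * i) • c i = 0) {i : ℕ} (hi : i < N) :
    c i = 0 := by
  refine SeparatingDual.eq_zero_of_forall_dual_eq_zero (R := ℂ) fun ψ => ?_
  let p : Polynomial ℂ := ∑ j ∈ Finset.range N, Polynomial.monomial (2 * j) (ψ (c j))
  have hinf : (Metric.sphere (0 : ℂ) 1).Infinite :=
    (isPreconnected_sphere (by simp [Complex.rank_real_complex]) 0 1).infinite_of_nontrivial
      ⟨1, by simp, -1, by simp, by norm_num⟩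
  have hp : p = 0 := by
    refine Polynomial.eq_zero_of_infinite_isRoot _ (hinf.mono fun ζ hζ => ?_)
    have := congrArg ψ (h ζ (by simpa using hζ))
    simpa [p, Polynomial.IsRoot, Polynomial.eval_finsetSum, mul_comm] using this
  have := congrArg (fun q => Polynomial.coeff q (2 * i)) hp
  simpa [p, Polynomial.finsetSum_coeff, Polynomial.coeff_monomial, hi] using this

/-- If a holomorphic function into a C⋆-algebra has normal values, then each Taylor coefficient
commutes with the adjoint of every other: compare coefficients of `z ^ n * conj z ^ m` in
`f z * star (f z) = star (f z) * f z`. -/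
lemma coeff_mul_star_coeff_comm {E : Type*} [CStarAlgebra E] {f : ℂ → E} {a : ℕ → E}
    (h : ∀ z ∈ Metric.ball (0 : ℂ) 1, HasSum (fun n : ℕ => z ^ n • a n) (f z))
    (hn : ∀ z ∈ Metric.ball (0 : ℂ) 1, IsStarNormal (f z)) (n m : ℕ) :
    a n * star (a m) = star (a m) * a n := by
  set C : ℕ → ℕ → E := fun i j => a i * star (a j) - star (a j) * a i with hC
  -- Restricting to the diameter through `ζ` separates the total degree `N = i + j`.
  have key : ∀ ζ : ℂ, ‖ζ‖ = 1 → ∀ N,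
      ∑ ij ∈ Finset.HasAntidiagonal.antidiagonal N, (ζ ^ ij.1 * (star ζ) ^ ij.2) • C ij.1 ij.2 = 0 := by
    intro ζ hζ
    set u : ℕ → E := fun i => ζ ^ i • a i with hu
    set v : ℕ → E := fun i => (star ζ) ^ i • star (a i) with hv
    have hC2 : ∀ N, ∑ ij ∈ Finset.HasAntidiagonal.antidiagonal N, (ζ ^ ij.1 * (star ζ) ^ ij.2) • C ij.1 ij.2
        = ∑ ij ∈ Finset.HasAntidiagonal.antidiagonal N, u ij.1 * v ij.2
          - ∑ ij ∈ Finset.HasAntidiagonal.antidiagonal N, v ij.1 * u ij.2 := by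
      intro N
      rw [← Finset.Nat.sum_antidiagonal_swap (f := fun ij => v ij.1 * u ij.2), ← Finset.sum_sub_distrib]
      refine Finset.sum_congr rfl fun ij _ => ?_
      simp only [hu, hv, hC, smul_sub, Prod.fst_swap, Prod.snd_swap, smul_mul_smul_comm]
      rw [mul_comm (star ζ ^ ij.2)]
    have hun : ∀ i, ‖u i‖ = ‖a i‖ := fun i => by simp [hu, norm_smul, hζ]
    have hvn : ∀ i, ‖v i‖ = ‖a i‖ := fun i => by simp [hv, norm_smul, hζ]
    have hsm : ∀ r : ℝ, 0 ≤ r → r < 1 → Summable (fun n : ℕ => ‖a n‖ * r ^ n) :=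
      fun r hr0 hr => summable_norm_mul_pow_of_hasSum h hr0 hr
    have hpow : ∀ (s : ℝ) (x y : ℕ → E) (N : ℕ),
        ∑ ij ∈ Finset.HasAntidiagonal.antidiagonal N, (s ^ ij.1 • x ij.1) * (s ^ ij.2 • y ij.2)
          = s ^ N • ∑ ij ∈ Finset.HasAntidiagonal.antidiagonal N, x ij.1 * y ij.2 := by
      intro s x y N
      rw [Finset.smul_sum]
      refine Finset.sum_congr rfl fun ij hij => ?_
      rw [smul_mul_smul_comm, ← pow_add, Finset.HasAntidiagonal.mem_antidiagonal.1 hij]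
    have hsx : ∀ (x : ℕ → E), (∀ i, ‖x i‖ = ‖a i‖) → ∀ s : ℝ, |s| < 1 →
        Summable (fun i => ‖s ^ i • x i‖) := by
      intro x hx s hs
      refine (hsm |s| (abs_nonneg s) hs).congr fun i => ?_
      simp [norm_smul, hx, mul_comm]
    intro N
    refine eq_zero_of_hasSum_zero (c := fun N =>
      ∑ ij ∈ Finset.HasAntidiagonal.antidiagonal N, (ζ ^ ij.1 * (star ζ) ^ ij.2) • C ij.1 ij.2)
      ?_ ?_ N
    · intro r hr0 hr1
      have hr : |r| < 1 := by rwa [abs_of_nonneg hr0]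
      have h1 := summable_norm_sum_mul_antidiagonal_of_summable_norm
        (hsx u hun r hr) (hsx v hvn r hr)
      have h2 := summable_norm_sum_mul_antidiagonal_of_summable_norm
        (hsx v hvn r hr) (hsx u hun r hr)
      refine Summable.of_nonneg_of_le (fun i => by positivity) (fun i => ?_) (h1.add h2)
      rw [hC2, hpow, hpow]
      simp only [norm_smul, norm_pow, Real.norm_eq_abs, abs_of_nonneg hr0]
      rw [← mul_add, mul_comm]
      gcongr
      exact norm_sub_le _ _
    · intro s hs
      have hs1 : |s| < 1 := by simpa using hs
      have hz : (s : ℂ) * ζ ∈ Metric.ball (0 : ℂ) 1 := by simpa [hζ] using hs1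
      have hu1 : HasSum (fun i => s ^ i • u i) (f (s * ζ)) := by
        refine (h _ hz).congr_fun fun i => ?_
        simp only [hu, mul_pow, mul_smul]
        rw [← Complex.ofReal_pow, Complex.coe_smul]
      have hv1 : HasSum (fun i => s ^ i • v i) (star (f (s * ζ))) := by
        refine hu1.star.congr_fun fun i => ?_
        simp [hu, hv, star_smul]
      have H1 := (summable_norm_sum_mul_antidiagonal_of_summable_norm
        (hsx u hun s hs1) (hsx v hvn s hs1)).of_norm.hasSum
      have H2 := (summable_norm_sum_mul_antidiagonal_of_summable_norm
        (hsx v hvn s hs1) (hsx u hun s hs1)).of_norm.hasSum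
      rw [← tsum_mul_tsum_eq_tsum_sum_antidiagonal_of_summable_norm (hsx u hun s hs1)
        (hsx v hvn s hs1), hu1.tsum_eq, hv1.tsum_eq] at H1
      rw [← tsum_mul_tsum_eq_tsum_sum_antidiagonal_of_summable_norm (hsx v hvn s hs1)
        (hsx u hun s hs1), hu1.tsum_eq, hv1.tsum_eq] at H2
      have H := H1.sub H2
      rw [(hn _ hz).star_comm_self.eq, sub_self] at H
      refine H.congr_fun fun i => ?_
      rw [hC2, hpow, hpow, smul_sub]
  -- After multiplication by `ζ ^ N`, the powers of `ζ` separate the bidegrees.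
  have hz : C n (n + m - n) = 0 := by
    refine eq_zero_of_sum_pow_smul_eq_zero (N := n + m + 1) (c := fun i => C i (n + m - i))
      (fun ζ hζ => ?_) (by omega)
    have h1 := congrArg (fun x => ζ ^ (n + m) • x) (key ζ hζ (n + m))
    simp only [smul_zero, Finset.smul_sum] at h1
    rw [Finset.Nat.sum_antidiagonal_eq_sum_range_succ_mk] at h1
    rw [← h1]
    refine Finset.sum_congr rfl fun i hi => ?_
    have hi' : i ≤ n + m := by simpa [Nat.lt_succ_iff] using hi
    have hc : ζ * star ζ = 1 := by
      rw [Complex.star_def, Complex.mul_conj, Complex.normSq_eq_norm_sq, hζ]; simp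
    rw [smul_smul]
    congr 1
    obtain ⟨k, hk⟩ := Nat.exists_eq_add_of_le hi'
    rw [hk, Nat.add_sub_cancel_left]
    calc ζ ^ (2 * i) = ζ ^ (2 * i) * (ζ * star ζ) ^ k := by rw [hc]; simp
      _ = _ := by ring
  rw [Nat.add_sub_cancel_left] at hz
  exact sub_eq_zero.1 hz

/-! ### Carathéodory's inequality and exponentials -/

open Real Complex in
lemma norm_circleAverage_le {f : ℂ → ℂ} {c : ℂ} {R : ℝ} :
    ‖circleAverage f c R‖ ≤ circleAverage (fun z => ‖f z‖) c R := by
  unfold circleAverage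
  rw [norm_smul, smul_eq_mul, Real.norm_eq_abs, abs_of_pos (by positivity)]
  gcongr
  exact intervalIntegral.norm_integral_le_integral_norm two_pi_pos.le

open Real Complex in
/-- **Carathéodory's inequality**: pairing `g` with `z ^ (-n)` on a circle gives the `n`-th
coefficient, while `conj g` pairs to zero, so `2 * re g ≥ 0` may be used in place of `g`. -/
lemma norm_iteratedDeriv_le_of_re_nonneg {g : ℂ → ℂ}
    (hg : DifferentiableOn ℂ g (Metric.ball 0 1))
    (hre : ∀ z ∈ Metric.ball (0 : ℂ) 1, 0 ≤ (g z).re) {n : ℕ} (hn : n ≠ 0) :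
    ‖iteratedDeriv n g 0‖ ≤ n.factorial * (2 * (g 0).re) := by
  -- On the circle of radius `s` the bound carries the factor `s ^ (-n)`; then `s` tends to `1`.
  have main : ∀ s : ℝ, 0 < s → s < 1 →
      s ^ n * ‖iteratedDeriv n g 0‖ ≤ n.factorial * (2 * (g 0).re) := by
    intro s hs0 hs1
    have hsub : Metric.closedBall (0 : ℂ) s ⊆ Metric.ball 0 1 := Metric.closedBall_subset_ball hs1
    have hd : DiffContOnCl ℂ g (Metric.ball 0 s) :=
      (hg.mono hsub).diffContOnCl_ball subset_rfl
    have hsph : ∀ z ∈ Metric.sphere (0 : ℂ) |s|, ‖z‖ = s := by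
      intro z hz; simpa [abs_of_pos hs0] using hz
    have hcont : ContinuousOn g (Metric.sphere 0 |s|) := by
      refine hg.continuousOn.mono fun z hz => ?_
      have := hsph z hz
      simpa [this] using hs1
    have hne : ∀ z ∈ Metric.sphere (0 : ℂ) |s|, z ≠ 0 := by
      intro z hz h0
      have := hsph z hz
      simp [h0] at this; exact hs0.ne this
    have hinv : ContinuousOn (fun z : ℂ => (z ^ n)⁻¹) (Metric.sphere 0 |s|) :=
      (continuousOn_id.pow n).inv₀ fun z hz => pow_ne_zero _ (hne z hz)
    have I1 : CircleIntegrable (fun z => (z ^ n)⁻¹ * g z) 0 s :=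
      ContinuousOn.circleIntegrable' (hinv.mul hcont)
    have I2 : CircleIntegrable (fun z => (z ^ n)⁻¹ * (starRingEnd ℂ) (g z)) 0 s :=
      ContinuousOn.circleIntegrable' (hinv.mul (continuous_conj.comp_continuousOn hcont))
    have I3 : CircleIntegrable (fun z => z ^ n * g z) 0 s :=
      ContinuousOn.circleIntegrable' ((continuousOn_id.pow n).mul hcont)
    have I4 : CircleIntegrable g 0 s := ContinuousOn.circleIntegrable' hcont
    have A1 : circleAverage (fun z => (z ^ n)⁻¹ * g z) 0 s
        = (n.factorial : ℂ)⁻¹ * iteratedDeriv n g 0 := by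
      have := hd.circleIntegral_one_div_sub_center_pow_smul hs0 n
      rw [circleAverage_eq_circleIntegral hs0.ne']
      have e : (fun z : ℂ => (z - 0)⁻¹ • ((z ^ n)⁻¹ * g z))
          = fun z => (1 / (z - 0) ^ (n + 1)) • g z := by
        funext z; simp only [sub_zero, smul_eq_mul, one_div, pow_succ, mul_inv]; ring
      rw [e, this, smul_smul, smul_eq_mul]
      have hpi : (π : ℂ) ≠ 0 := by exact_mod_cast pi_ne_zero
      field_simp
    have A3 : circleAverage (fun z => z ^ n * g z) 0 s = 0 := by
      have hd' : DiffContOnCl ℂ (fun z => z ^ n * g z) (Metric.ball 0 |s|) := by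
        rw [abs_of_pos hs0]
        exact (differentiable_id.pow n).diffContOnCl.smul hd
      rw [hd'.circleAverage]; simp [hn]
    have A2 : circleAverage (fun z => (z ^ n)⁻¹ * (starRingEnd ℂ) (g z)) 0 s = 0 := by
      have h1 : circleAverage ((conjCLE : ℂ →L[ℝ] ℂ) ∘ fun z => z ^ n * g z) 0 s = 0 := by
        rw [ContinuousLinearMap.circleAverage_comp_comm _ I3, A3]; simp
      have h2 : circleAverage (fun z => (z ^ n)⁻¹ * (starRingEnd ℂ) (g z)) 0 s
          = circleAverage (fun z => (((s : ℂ) ^ (2 * n))⁻¹) •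
              ((conjCLE : ℂ →L[ℝ] ℂ) ∘ fun z => z ^ n * g z) z) 0 s := by
        refine circleAverage_congr_sphere fun z hz => ?_
        have h3 : z * (starRingEnd ℂ) z = (s : ℂ) ^ 2 := by
          rw [mul_conj, normSq_eq_norm_sq, hsph z hz]; simp
        have hs' : (s : ℂ) ≠ 0 := by exact_mod_cast hs0.ne'
        have hz0 := hne z hz
        have h4 : ((starRingEnd ℂ) z) ^ n * z ^ n = (s : ℂ) ^ (2 * n) := by
          rw [← mul_pow, mul_comm, h3, pow_mul]
        simp only [Function.comp_apply, ContinuousLinearEquiv.coe_coe, conjCLE_apply, map_mul,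
          map_pow, smul_eq_mul]
        field_simp
        rw [← h4]; ring
      rw [h2, circleAverage_fun_smul, h1, smul_zero]
    have A4 : circleAverage (fun z => (g z).re) 0 s = (g 0).re := by
      have hd' : DiffContOnCl ℂ g (Metric.ball 0 |s|) := by rwa [abs_of_pos hs0]
      have := ContinuousLinearMap.circleAverage_comp_comm reCLM I4
      rw [hd'.circleAverage] at this
      exact this
    have A5 : (n.factorial : ℂ)⁻¹ * iteratedDeriv n g 0
        = circleAverage (fun z => (z ^ n)⁻¹ * (2 * (g z).re : ℝ)) 0 s := by
      have h1 := circleAverage_fun_add I1 I2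
      rw [A1, A2, add_zero] at h1
      rw [← h1]
      congr 1; funext z
      rw [← mul_add, add_conj]
    have A6 : ‖(n.factorial : ℂ)⁻¹ * iteratedDeriv n g 0‖ ≤ (s ^ n)⁻¹ * (2 * (g 0).re) := by
      rw [A5]
      refine norm_circleAverage_le.trans_eq ?_
      have : circleAverage (fun z => ‖(z ^ n)⁻¹ * ((2 * (g z).re : ℝ) : ℂ)‖) 0 s
          = circleAverage (fun z => ((s ^ n)⁻¹ * 2) • (g z).re) 0 s := by
        refine circleAverage_congr_sphere fun z hz => ?_
        have hz' : z ∈ Metric.ball (0 : ℂ) 1 := by simpa [hsph z hz] using hs1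
        have := hre z hz'
        simp only [norm_mul, norm_inv, norm_pow, hsph z hz, norm_real, smul_eq_mul]
        rw [Real.norm_of_nonneg (by positivity)]; simp [abs_of_nonneg this]; ring
      rw [this, circleAverage_fun_smul, A4, smul_eq_mul]; ring
    have hf : (0 : ℝ) < n.factorial := by positivity
    rw [norm_mul, norm_inv, Complex.norm_natCast, inv_mul_le_iff₀ hf] at A6
    calc s ^ n * ‖iteratedDeriv n g 0‖ ≤ s ^ n * (n.factorial * ((s ^ n)⁻¹ * (2 * (g 0).re))) := by
          gcongr
      _ = _ := by field_simp
  have hlim : Filter.Tendsto (fun s : ℝ => s ^ n * ‖iteratedDeriv n g 0‖)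
      (nhdsWithin 1 (Set.Iio 1)) (nhds (1 ^ n * ‖iteratedDeriv n g 0‖)) :=
    Filter.Tendsto.mono_left
      (Continuous.tendsto (by fun_prop) 1) nhdsWithin_le_nhds
  rw [one_pow, one_mul] at hlim
  refine le_of_tendsto hlim ?_
  filter_upwards [Ioo_mem_nhdsLT (zero_lt_one' ℝ)] with s hs
  exact main s hs.1 hs.2

/-- The derivatives of `exp ∘ g` at a point, in terms of those of `g`. -/
lemma iteratedDeriv_succ_cexp {g : ℂ → ℂ} {x : ℂ} (hg : AnalyticAt ℂ g x) (n : ℕ) :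
    iteratedDeriv (n + 1) (fun z => Complex.exp (g z)) x
      = ∑ i ∈ Finset.range (n + 1), n.choose i * iteratedDeriv (i + 1) g x
          * iteratedDeriv (n - i) (fun z => Complex.exp (g z)) x := by
  rw [iteratedDeriv_succ']
  have h : deriv (fun z => Complex.exp (g z)) =ᶠ[nhds x]
      deriv g * fun z => Complex.exp (g z) := by
    filter_upwards [hg.eventually_analyticAt] with z hz
    have := hz.differentiableAt.hasDerivAt.cexp.deriv
    rw [this]; simp [mul_comm]
  rw [h.iteratedDeriv_eq, iteratedDeriv_mul hg.deriv.contDiffAt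
    (g := fun z => Complex.exp (g z)) hg.cexp.contDiffAt]
  simp_rw [← iteratedDeriv_succ']

/-- Exponentiation preserves coefficientwise domination. -/
lemma iteratedDeriv_cexp_le {g G : ℂ → ℂ} (hg : AnalyticAt ℂ g 0) (hG : AnalyticAt ℂ G 0)
    (h0 : (g 0).re ≤ (G 0).re) (h0' : (G 0).im = 0) {d : ℕ → ℝ}
    (hGd : ∀ n, iteratedDeriv (n + 1) G 0 = d n)
    (hgd : ∀ n, ‖iteratedDeriv (n + 1) g 0‖ ≤ d n) (n : ℕ) :
    ∃ m : ℝ, iteratedDeriv n (fun z => Complex.exp (G z)) 0 = m ∧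
      ‖iteratedDeriv n (fun z => Complex.exp (g z)) 0‖ ≤ m := by
  induction n using Nat.strong_induction_on with
  | _ n ih =>
    rcases n with _ | n
    · refine ⟨Real.exp (G 0).re, ?_, ?_⟩
      · have : G 0 = ((G 0).re : ℂ) := Complex.ext (by simp) (by simp [h0'])
        rw [iteratedDeriv_zero, Complex.ofReal_exp, ← this]
      · rw [iteratedDeriv_zero, Complex.norm_exp]
        exact Real.exp_le_exp.2 h0
    · choose! m hm1 hm2 using ih
      refine ⟨∑ i ∈ Finset.range (n + 1), n.choose i * d i * m (n - i), ?_, ?_⟩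
      · rw [iteratedDeriv_succ_cexp hG]
        push_cast
        refine Finset.sum_congr rfl fun i hi => ?_
        rw [hGd, hm1 (n - i) (by omega)]
      · rw [iteratedDeriv_succ_cexp hg]
        refine norm_sum_le_of_le _ fun i hi => ?_
        rw [norm_mul, norm_mul, Complex.norm_natCast]
        have := (norm_nonneg _).trans (hgd i)
        gcongr
        · exact hgd i
        · exact hm2 (n - i) (by omega)

/-- A holomorphic function on the unit disc without zeros has a logarithm. -/
lemma exists_cexp_eq {φ : ℂ → ℂ} (hφ : DifferentiableOn ℂ φ (Metric.ball 0 1))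
    (hne : ∀ z ∈ Metric.ball (0 : ℂ) 1, φ z ≠ 0) {y : ℂ} (hy : Complex.exp y = φ 0) :
    ∃ g : ℂ → ℂ, DifferentiableOn ℂ g (Metric.ball 0 1) ∧ g 0 = y ∧
      ∀ z ∈ Metric.ball (0 : ℂ) 1, φ z = Complex.exp (g z) := by
  have hd : DifferentiableOn ℂ (fun z => deriv φ z / φ z) (Metric.ball 0 1) :=
    (hφ.deriv Metric.isOpen_ball).div hφ hne
  obtain ⟨g, hg0, hg⟩ := hd.isExactOn_ball.with_val_at 0 y
  have h0 : (0 : ℂ) ∈ Metric.ball (0 : ℂ) 1 := by simp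
  refine ⟨g, fun z hz => (hg z hz).differentiableAt.differentiableWithinAt, hg0, ?_⟩
  have hder : ∀ z ∈ Metric.ball (0 : ℂ) 1,
      HasDerivAt (fun z => φ z * Complex.exp (-g z)) 0 z := by
    intro z hz
    have h1 := (hφ.differentiableAt (Metric.isOpen_ball.mem_nhds hz)).hasDerivAt
    refine (h1.mul (hg z hz).neg.cexp).congr_deriv ?_
    have := hne z hz
    simp only [Pi.neg_apply]
    field_simp
    ring
  intro z hz
  -- `φ * exp (-g)` has derivative zero, and its value at `0` is `1`.
  have hconst := Metric.isOpen_ball.is_const_of_deriv_eq_zero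
    (convex_ball (0 : ℂ) 1).isPreconnected
    (fun w hw => (hder w hw).differentiableAt.differentiableWithinAt)
    (fun w hw => (hder w hw).deriv) hz h0
  simp only [hg0, Complex.exp_neg, ← hy] at hconst
  rw [mul_inv_cancel₀ (Complex.exp_ne_zero y), ← div_eq_mul_inv,
    div_eq_one_iff_eq (Complex.exp_ne_zero _)] at hconst
  exact hconst

/-! ### The extremal function -/

/-- The extremal function `exp (L * (1 + z) / (1 - z))`: among the holomorphic functions on the
disc of modulus at least `1` whose value at `0` lies in `[1, exp L]`, it has the largest Taylor
coefficients. -/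
noncomputable def expCayley (L : ℝ) (z : ℂ) : ℂ := Complex.exp (2 * L * (1 - z)⁻¹ - L)

lemma one_sub_ne_zero_of_mem_ball {z : ℂ} (hz : z ∈ Metric.ball (0 : ℂ) 1) : 1 - z ≠ 0 := by
  intro h
  rw [← sub_eq_zero.1 h] at hz
  simp at hz

lemma differentiableOn_cayley (L : ℝ) :
    DifferentiableOn ℂ (fun z : ℂ => 2 * (L : ℂ) * (1 - z)⁻¹ - L) (Metric.ball 0 1) :=
  (((differentiableOn_const _).sub differentiableOn_id).inv
    (fun _ hz => one_sub_ne_zero_of_mem_ball hz)).const_mul _ |>.sub_const _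

lemma iteratedDeriv_succ_cayley (L : ℝ) (n : ℕ) :
    iteratedDeriv (n + 1) (fun z : ℂ => 2 * (L : ℂ) * (1 - z)⁻¹ - L) 0
      = (((n + 1).factorial * (2 * L) : ℝ) : ℂ) := by
  have h : ∀ z ∈ Metric.ball (0 : ℂ) 1,
      HasSum (fun n : ℕ => z ^ n • (2 * (L : ℂ) - if n = 0 then (L : ℂ) else 0))
        (2 * (L : ℂ) * (1 - z)⁻¹ - L) := by
    intro z hz
    have h1 := (hasSum_geometric_of_norm_lt_one (by simpa using hz : ‖z‖ < 1)).mul_left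
      (2 * (L : ℂ))
    refine (h1.sub (hasSum_ite_eq 0 (L : ℂ))).congr_fun fun n => ?_
    rcases n with _ | n
    · simp
    · simp [mul_comm]
  rw [iteratedDeriv_eq_factorial_mul_of_hasSum h]
  simp

/-- The `n`-th Taylor coefficient of `expCayley L` at `0`. It is real, because all derivatives of
`2 * L / (1 - z) - L` at `0` are; the real part makes it an element of `ℝ`. -/
noncomputable def expCayleyCoeff (L : ℝ) (n : ℕ) : ℝ :=
  (n.factorial : ℝ)⁻¹ * (iteratedDeriv n (expCayley L) 0).re

/-- Scalar coefficient bound: write `φ = exp g` with `0 ≤ re g` and `g 0 = log (φ 0) ≤ L`, bound the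
coefficients of `g` by Carathéodory's inequality, and exponentiate. -/
lemma norm_coeff_le_expCayleyCoeff {φ : ℂ → ℂ} {c : ℕ → ℂ}
    (h : ∀ z ∈ Metric.ball (0 : ℂ) 1, HasSum (fun n : ℕ => z ^ n • c n) (φ z))
    (h1 : ∀ z ∈ Metric.ball (0 : ℂ) 1, 1 ≤ ‖φ z‖) {L a : ℝ} (ha : 0 ≤ a) (hφ : c 0 = a)
    (hL : a ≤ Real.exp L) (n : ℕ) :
    ‖c n‖ ≤ expCayleyCoeff L n := by
  have h0 : (0 : ℂ) ∈ Metric.ball (0 : ℂ) 1 := by simp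
  have hφ0 : φ 0 = a := by
    refine (h 0 h0).unique ?_
    rw [← hφ]
    simpa using hasSum_single (f := fun n : ℕ => (0 : ℂ) ^ n • c n) 0
      (fun n hn => by simp [hn])
  have hd : DifferentiableOn ℂ φ (Metric.ball 0 1) := by
    have := (hasFPowerSeriesOnBall_mkPiRing
      (fun r hr0 hr => summable_norm_mul_pow_of_hasSum h hr0 hr) h).differentiableOn
    refine this.mono fun z hz => ?_
    simpa [Metric.mem_eball, edist_zero_right, enorm, ← NNReal.coe_lt_coe] using hz
  have ha1 : 1 ≤ a := by
    have := h1 0 h0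
    rwa [hφ0, Complex.norm_real, Real.norm_of_nonneg ha] at this
  have hapos : 0 < a := by linarith
  obtain ⟨g, hg, hg0, hge⟩ := exists_cexp_eq hd
    (fun z hz h => by have := h1 z hz; rw [h, norm_zero] at this; linarith)
    (y := Real.log a) (by rw [← Complex.ofReal_exp, Real.exp_log hapos, hφ0])
  have hlog : Real.log a ≤ L := (Real.log_le_iff_le_exp hapos).2 hL
  have hre : ∀ z ∈ Metric.ball (0 : ℂ) 1, 0 ≤ (g z).re := by
    intro z hz
    have := h1 z hz
    rwa [hge z hz, Complex.norm_exp, Real.one_le_exp_iff] at this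
  have hnhds := Metric.isOpen_ball.mem_nhds h0
  obtain ⟨m, hm1, hm2⟩ := iteratedDeriv_cexp_le (hg.analyticAt hnhds)
    ((differentiableOn_cayley L).analyticAt hnhds)
    (by simp [hg0]; linarith) (by simp)
    (iteratedDeriv_succ_cayley L)
    (fun k => by
      refine (norm_iteratedDeriv_le_of_re_nonneg hg hre k.succ_ne_zero).trans ?_
      rw [hg0, Complex.ofReal_re]
      gcongr) n
  have hm1' : iteratedDeriv n (expCayley L) 0 = m := hm1
  have heq : φ =ᶠ[nhds 0] fun z => Complex.exp (g z) :=
    Filter.eventually_of_mem hnhds hge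
  rw [← heq.iteratedDeriv_eq, iteratedDeriv_eq_factorial_mul_of_hasSum h, norm_mul,
    Complex.norm_natCast] at hm2
  rw [expCayleyCoeff, hm1', Complex.ofReal_re, le_inv_mul_iff₀ (by positivity)]
  exact hm2

lemma hasSum_expCayleyCoeff {L r : ℝ} (hr0 : 0 ≤ r) (hr : r < 1) :
    HasSum (fun n => expCayleyCoeff L n * r ^ n) (Real.exp (2 * L * (1 - r)⁻¹ - L)) := by
  have hd : DifferentiableOn ℂ (expCayley L) (Metric.ball 0 1) := (differentiableOn_cayley L).cexp
  have hrb : (r : ℂ) ∈ Metric.ball (0 : ℂ) 1 := by simpa [abs_of_nonneg hr0] using hr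
  have h := Complex.hasSum_taylorSeries_on_ball hd hrb
  have h2 := Complex.hasSum_re h
  have h3 : (expCayley L r).re = Real.exp (2 * L * (1 - r)⁻¹ - L) := by
    rw [← Complex.ofReal_re (Real.exp _), expCayley]; push_cast; rfl
  rw [h3] at h2
  refine h2.congr_fun fun n => ?_
  have : ((n.factorial : ℂ)⁻¹ • ((r : ℂ) - 0) ^ n • iteratedDeriv n (expCayley L) 0)
      = ((((n.factorial : ℝ)⁻¹ * r ^ n : ℝ)) : ℂ) * iteratedDeriv n (expCayley L) 0 := by
    push_cast; simp [mul_assoc]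
  rw [this, Complex.re_ofReal_mul, expCayleyCoeff]; ring

/-! ### Coefficient bounds in C⋆-algebras -/

/-- In a commutative C⋆-algebra, the coefficient bound follows from the scalar one along every
character. -/
lemma norm_coeff_le_of_commCStarAlgebra {E : Type*} [CommCStarAlgebra E] [Nontrivial E]
    {f : ℂ → E} {a : ℕ → E}
    (h : ∀ z ∈ Metric.ball (0 : ℂ) 1, HasSum (fun n : ℕ => z ^ n • a n) (f z))
    (hlow : ∀ z ∈ Metric.ball (0 : ℂ) 1, ∀ t : ℝ, (t : ℂ) ∈ spectrum ℂ (star (f z) * f z) → 1 ≤ t)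
    (hpos : ∀ w ∈ spectrum ℂ (a 0), ∃ t : ℝ, 0 ≤ t ∧ w = t)
    {L : ℝ} (hL : ‖a 0‖ ≤ Real.exp L) (n : ℕ) : ‖a n‖ ≤ expCayleyCoeff L n := by
  have key : ∀ χ : WeakDual.characterSpace ℂ E, ‖χ (a n)‖ ≤ expCayleyCoeff L n := by
    intro χ
    have hc : ∀ x, ‖χ x‖ ≤ ‖x‖ := fun x => AlgHom.norm_apply_le_self χ x
    have hmem : ∀ x, χ x ∈ spectrum ℂ x := fun x => AlgHom.apply_mem_spectrum χ x
    obtain ⟨t, ht0, ht⟩ := hpos _ (hmem (a 0))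
    refine (norm_coeff_le_expCayleyCoeff (φ := fun z => χ (f z)) (c := fun n => χ (a n))
      (fun z hz => ?_) (fun z hz => ?_) ht0 ht ?_ n)
    · refine ((h z hz).map χ (map_continuous χ)).congr_fun fun k => ?_
      simp
    · have h1 := hmem (star (f z) * f z)
      rw [map_mul, map_star, Complex.star_def, Complex.conj_mul', ← Complex.ofReal_pow] at h1
      have h2 := hlow z hz _ h1
      exact (one_le_sq_iff₀ (norm_nonneg _)).1 h2
    · have := (hc (a 0)).trans hL
      rwa [ht, Complex.norm_real, Real.norm_of_nonneg ht0] at this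
  rw [← (AddMonoidHomClass.isometry_iff_norm _).1 (gelfandTransform_isometry E) (a n)]
  exact (ContinuousMap.norm_le_of_nonempty _).2 key

/-- The values of a normal-valued holomorphic function generate a commutative C⋆-algebra, since
its coefficients commute with each other's adjoints and hence, by Fuglede's theorem, with each
other. -/
lemma norm_coeff_le_of_isStarNormal {E : Type*} [CStarAlgebra E] [Nontrivial E]
    {f : ℂ → E} {a : ℕ → E}
    (h : ∀ z ∈ Metric.ball (0 : ℂ) 1, HasSum (fun n : ℕ => z ^ n • a n) (f z))
    (hn : ∀ z ∈ Metric.ball (0 : ℂ) 1, IsStarNormal (f z))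
    (hlow : ∀ z ∈ Metric.ball (0 : ℂ) 1, ∀ t : ℝ, (t : ℂ) ∈ spectrum ℂ (star (f z) * f z) → 1 ≤ t)
    (hpos : ∀ w ∈ spectrum ℂ (a 0), ∃ t : ℝ, 0 ≤ t ∧ w = t)
    {L : ℝ} (hL : ‖a 0‖ ≤ Real.exp L) (n : ℕ) : ‖a n‖ ≤ expCayleyCoeff L n := by
  have hstar := coeff_mul_star_coeff_comm h hn
  have hcomm : ∀ n m, a n * a m = a m * a n := fun n m => by
    have hm : IsStarNormal (star (a m)) := ⟨by simpa [Commute, SemiconjBy] using hstar m m⟩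
    simpa using (hm.commute_star_right (x := a n) (hstar n m)).eq
  have hS : IsMulCommutative (StarAlgebra.adjoin ℂ (Set.range a)) :=
    StarAlgebra.isMulCommutative_adjoin ℂ
      (by rintro _ ⟨i, rfl⟩ _ ⟨j, rfl⟩; exact hcomm i j)
      (by rintro _ ⟨i, rfl⟩ _ ⟨j, rfl⟩; exact hstar i j)
  let S := (StarAlgebra.adjoin ℂ (Set.range a)).topologicalClosure
  have hScl : IsClosed (S : Set E) := StarSubalgebra.isClosed_topologicalClosure _
  let _ : CommCStarAlgebra S :=
    { StarSubalgebra.cstarAlgebra S with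
      mul_comm := (StarSubalgebra.commRingTopologicalClosure _
        (fun x y => hS.is_comm.comm x y)).mul_comm }
  have ha : ∀ i, a i ∈ S := fun i =>
    StarSubalgebra.le_topologicalClosure _ (StarAlgebra.subset_adjoin ℂ _ ⟨i, rfl⟩)
  have hf : ∀ z ∈ Metric.ball (0 : ℂ) 1, f z ∈ S := fun z hz =>
    hScl.mem_of_tendsto (h z hz) (Filter.Eventually.of_forall fun s =>
      sum_mem fun i _ => S.smul_mem (ha i) _)
  classical
  -- Outside the disc `f` need not take values in `S`.
  let F : ℂ → S := fun z => if hz : z ∈ Metric.ball (0 : ℂ) 1 then ⟨f z, hf z hz⟩ else 0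
  have hF : ∀ z ∈ Metric.ball (0 : ℂ) 1, (F z : E) = f z := fun z hz => by simp only [F, dif_pos hz]
  refine norm_coeff_le_of_commCStarAlgebra (E := S) (f := F) (a := fun i => ⟨a i, ha i⟩)
    (fun z hz => ?_) (fun z hz t ht => ?_) (fun w hw => ?_) hL n
  · refine (Topology.IsInducing.subtypeVal.hasSum_iff
      (g := (S.subtype : S →⋆ₐ[ℂ] E)) _ _).1 ?_
    simpa [Function.comp_def, hF z hz] using h z hz
  · rw [StarSubalgebra.mem_spectrum_iff] at ht
    refine hlow z hz t ?_
    simpa [hF z hz] using ht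
  · rw [StarSubalgebra.mem_spectrum_iff] at hw
    exact hpos w hw

/-- If `1 ≤ |T|`, then the spectrum of `T⋆ T = |T|²` lies to the right of `1`. -/
lemma one_le_of_mem_spectrum_star_mul_self {H : Type*} [NormedAddCommGroup H]
    [InnerProductSpace ℂ H] [CompleteSpace H] {T : H →L[ℂ] H} (hT : 1 ≤ CFC.abs T) {t : ℝ}
    (ht : (t : ℂ) ∈ spectrum ℂ (star T * T)) : 1 ≤ t := by
  have h1 : 1 ≤ star T * T := by
    have h := CFC.abs_mul_abs T
    have hd : 0 ≤ CFC.abs T - 1 := sub_nonneg.2 hT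
    have h2 : 0 ≤ (CFC.abs T - 1) * (CFC.abs T - 1) := by
      have := star_mul_self_nonneg (CFC.abs T - 1)
      rwa [hd.star_eq] at this
    rw [← h, ← sub_nonneg]
    have e : CFC.abs T * CFC.abs T - 1
        = (CFC.abs T - 1) * (CFC.abs T - 1) + ((CFC.abs T - 1) + (CFC.abs T - 1)) := by
      noncomm_ring
    rw [e]
    exact add_nonneg h2 (add_nonneg hd hd)
  have ht' : t - 1 ∈ spectrum ℝ (star T * T - 1) := by
    have : t ∈ spectrum ℝ (star T * T) := (spectrum.algebraMap_mem_iff ℂ).1 ht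
    have h3 := spectrum.sub_singleton_eq (star T * T) (1 : ℝ)
    rw [map_one] at h3
    rw [← h3]
    exact Set.sub_mem_sub this rfl
  have := spectrum_nonneg_of_nonneg (sub_nonneg.2 h1) ht'
  linarith

/-! ### The Bohr-type inequality -/

/-- Spherical distances from `a ≥ 1`: points of `[a, a ^ 2]` are at most as far as `1`. -/
lemma sphericalDist_le_of_mem_Icc {a s : ℝ} (ha : 1 ≤ a) (has : a ≤ s) (hs : s ≤ a ^ 2) :
    sphericalDist ((s : ℂ) : OnePoint ℂ) ((a : ℂ) : OnePoint ℂ)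
      ≤ sphericalDist ((a : ℂ) : OnePoint ℂ) ((1 : ℂ) : OnePoint ℂ) := by
  have h1 : sphericalDist ((s : ℂ) : OnePoint ℂ) ((a : ℂ) : OnePoint ℂ)
      = (s - a) / (√(1 + s ^ 2) * √(1 + a ^ 2)) := by
    change ‖(s : ℂ) - a‖ / (√(1 + ‖(s : ℂ)‖ ^ 2) * √(1 + ‖(a : ℂ)‖ ^ 2)) = _
    rw [← Complex.ofReal_sub, Complex.norm_real, Complex.norm_real, Complex.norm_real,
      Real.norm_of_nonneg (by linarith), Real.norm_of_nonneg (by linarith),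
      Real.norm_of_nonneg (by linarith)]
  have h2 : sphericalDist ((a : ℂ) : OnePoint ℂ) ((1 : ℂ) : OnePoint ℂ)
      = (a - 1) / (√(1 + a ^ 2) * √2) := by
    change ‖(a : ℂ) - 1‖ / (√(1 + ‖(a : ℂ)‖ ^ 2) * √(1 + ‖(1 : ℂ)‖ ^ 2)) = _
    rw [← Complex.ofReal_one, ← Complex.ofReal_sub, Complex.norm_real, Complex.norm_real,
      Complex.norm_real, Real.norm_of_nonneg (by linarith), Real.norm_of_nonneg (by linarith),
      Real.norm_of_nonneg (by linarith)]
    norm_num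
  rw [h1, h2, mul_comm √(1 + a ^ 2), ← div_div, ← div_div]
  gcongr ?_ / _
  rw [div_le_div_iff₀ (by positivity) (by positivity)]
  refine le_of_sq_le_sq ?_ (mul_nonneg (by linarith) (by positivity))
  rw [mul_pow, mul_pow, Real.sq_sqrt (by norm_num), Real.sq_sqrt (by positivity)]
  have h3 : (a * (s - a)) ^ 2 ≤ (s * (a - 1)) ^ 2 :=
    pow_le_pow_left₀ (mul_nonneg (by linarith) (by linarith)) (by linarith) 2
  have h4 : 2 * s ^ 2 ≤ a ^ 2 * (1 + s ^ 2) := by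
    have hs2 : s ^ 2 ≤ (a ^ 2) ^ 2 := pow_le_pow_left₀ (by linarith) hs 2
    rcases le_total 2 (a ^ 2) with h | h
    · nlinarith [sq_nonneg s]
    · nlinarith [mul_nonneg (sub_nonneg.2 h) (sub_nonneg.2 hs2),
        mul_nonneg (sq_nonneg a) (sq_nonneg (a ^ 2 - 1))]
  have h5 : a ^ 2 * ((s - a) ^ 2 * 2) ≤ a ^ 2 * ((a - 1) ^ 2 * (1 + s ^ 2)) := by
    nlinarith [mul_le_mul_of_nonneg_right h4 (sq_nonneg (a - 1))]
  exact le_of_mul_le_mul_left h5 (by positivity)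

theorem mainTheorem2 {H : Type*} [NormedAddCommGroup H] [InnerProductSpace ℂ H] [CompleteSpace H]
    (f : ℂ → (H →L[ℂ] H)) (A : ℕ → (H →L[ℂ] H))
    (hf : DifferentiableOn ℂ f (Metric.ball 0 1))
    (hA : ∀ z ∈ Metric.ball (0 : ℂ) 1, HasSum (fun n : ℕ => z ^ n • A n) (f z))
    (habs : ∀ z ∈ Metric.ball (0 : ℂ) 1, OpStrictLT 1 (CFC.abs (f z)))
    (hnormal : ∀ z ∈ Metric.ball (0 : ℂ) 1, IsStarNormal (f z))
    (hA0 : OpStrictLT 0 (A 0))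
    (hsep : ∀ z ∈ Metric.ball (0 : ℂ) 1, NotSeparatesZeroInfty (spectrum ℂ (f z)))
    (ρ : ℝ) (hρ : ρ = Real.log ‖A 0‖ / ‖CFC.log (A 0)‖)
    (r : ℝ) (hr0 : 0 ≤ r) (hr : r ≤ (2 * ρ - 1) / (2 * ρ + 1)) :
    Summable (fun n : ℕ => ‖A n‖ * r ^ n) ∧
      sphericalDist (((∑' n : ℕ, ‖A n‖ * r ^ n : ℝ) : ℂ) : OnePoint ℂ)
          (((‖A 0‖ : ℝ) : ℂ) : OnePoint ℂ) ≤
        sphericalDist (((‖A 0‖ : ℝ) : ℂ) : OnePoint ℂ) ((1 : ℂ) : OnePoint ℂ) := by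
  have h0 : (0 : ℂ) ∈ Metric.ball (0 : ℂ) 1 := by simp
  have habs' : ∀ z ∈ Metric.ball (0 : ℂ) 1, 1 ≤ CFC.abs (f z) := fun z hz =>
    (ContinuousLinearMap.le_def _ _).2 (habs z hz).1
  have hpos : 0 ≤ A 0 := (ContinuousLinearMap.le_def _ _).2 hA0.1
  have hf0 : f 0 = A 0 := by
    refine (hA 0 h0).unique ?_
    simpa using hasSum_single (f := fun n : ℕ => (0 : ℂ) ^ n • A n) 0
      (fun n hn => by simp [hn])
  have hone : 1 ≤ A 0 := by
    have := habs' 0 h0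
    rwa [hf0, CFC.abs_of_nonneg _ hpos] at this
  rcases subsingleton_or_nontrivial H with hH | hH
  · -- On the zero space `ρ = log 0 / 0 = 0`, and no `r ≥ 0` is admissible.
    have : A 0 = 0 := Subsingleton.elim _ _
    rw [this, norm_zero, Real.log_zero, zero_div] at hρ
    rw [hρ] at hr
    norm_num at hr
    linarith
  have hnorm : 1 ≤ ‖A 0‖ := by
    simpa using CStarAlgebra.norm_le_norm_of_nonneg_of_le zero_le_one hone
  set L := Real.log ‖A 0‖ with hLdef
  have hL0 : 0 ≤ L := Real.log_nonneg hnorm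
  have hexpL : Real.exp L = ‖A 0‖ := Real.exp_log (by linarith)
  -- As `log ‖A 0‖` lies in the spectrum of `log (A 0)`, `ρ ≤ 1` and therefore `r ≤ 1 / 3`.
  have hLlog : L ≤ ‖CFC.log (A 0)‖ := by
    have hu : (0 : ℝ) ∉ spectrum ℝ (A 0) :=
      spectrum.zero_notMem ℝ (CStarAlgebra.isUnit_of_le 1 hone)
    have hcont : ContinuousOn Real.log (spectrum ℝ (A 0)) :=
      Real.continuousOn_log.mono fun x hx h => hu (Set.mem_singleton_iff.1 h ▸ hx)
    exact (Real.le_norm_self L).trans (norm_apply_le_norm_cfc Real.log (A 0)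
      (CStarAlgebra.norm_mem_spectrum_of_nonneg hpos) hcont (IsSelfAdjoint.of_nonneg hpos))
  have hρ0 : 0 ≤ ρ := by rw [hρ]; positivity
  have hρ1 : ρ ≤ 1 := by rw [hρ]; exact div_le_one_of_le₀ hLlog (norm_nonneg _)
  have hr3 : r ≤ 1 / 3 := by
    refine hr.trans ?_
    rw [div_le_div_iff₀ (by linarith) (by norm_num)]
    linarith
  have hcoeff : ∀ n, ‖A n‖ ≤ expCayleyCoeff L n :=
    norm_coeff_le_of_isStarNormal hA hnormal
      (fun z hz t ht => one_le_of_mem_spectrum_star_mul_self (habs' z hz) ht)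
      (fun w hw => by
        have hw' := (IsSelfAdjoint.of_nonneg hpos).mem_spectrum_eq_re hw
        rw [hw'] at hw
        exact ⟨w.re, spectrum_nonneg_of_nonneg hpos ((spectrum.algebraMap_mem_iff ℂ).1 hw), hw'⟩)
      hexpL.ge
  have hmaj := hasSum_expCayleyCoeff (L := L) hr0 (by linarith)
  have hle : ∀ n, ‖A n‖ * r ^ n ≤ expCayleyCoeff L n * r ^ n := fun n => by
    gcongr
    exact hcoeff n
  have hsum : Summable (fun n : ℕ => ‖A n‖ * r ^ n) :=
    Summable.of_nonneg_of_le (fun n => by positivity) hle hmaj.summable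
  refine ⟨hsum, sphericalDist_le_of_mem_Icc hnorm ?_ ?_⟩
  · simpa using hsum.le_tsum 0 (fun n _ => by positivity)
  · refine (hsum.tsum_le_tsum hle hmaj.summable).trans ?_
    rw [hmaj.tsum_eq, ← hexpL, ← Real.exp_nat_mul, Real.exp_le_exp]
    -- At `r = 1 / 3` the exponent `L * (1 + r) / (1 - r)` equals `2 * L`.
    have h1 : (1 - r)⁻¹ ≤ 3 / 2 := by
      rw [inv_le_comm₀ (by linarith) (by norm_num)]
      norm_num
      linarith
    push_cast
    nlinarith
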